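/- Let $r\ge 2$, let $\mathbb F=\mathbb F_r=\langle a_1,\dots,a_r\rangle$ be the free group of rank $r$, and let $|g|$ denote the length of the reduced word representing $g\in\mathbb F$ in the letters $a_1^{\pm1},\dots,a_r^{\pm1}$. Let $\mathbb F$ act by measure-preserving measurable transformations on a probability space $(X,\mu)$. For $n\ge 0$ let $S_n=\{g\in\mathbb F: |g|=n\}$, and for a function $f$ on $X$ put $$\sigma_n(f)(x)=\frac1{|S_n|}\sum_{g\in S_n} f(g^{-1}x).$$ Then for every (real- or complex-valued) $f\in L\log L(X,\mu)$, i.e. every measurable $f$ with $\int_X |f|\log^+|f|\,d\mu<\infty$, where $\log^+ t=\max(0,\log t)$ and $0\log^+0=0$, the averages $$\frac1{n+1}\sum_{i=0}^n\sigma_i(f)$$ converge pointwise $\mu$-almost everywhere as $n\to\infty$ to $\mathbb E[f\mid\mathbb F]$, the conditional expectation of $f$ on the $\sigma$-algebra of $\mathbb F$-invariant measurable subsets of $X$. -/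

import Mathlib

open MeasureTheory Filter Topology

/-- The set of elements of word length `n` in the free group of rank `r`, with respect to the free
generators and their inverses, is finite: such an element is given by a reduced word of `n` letters
in the finite alphabet `Fin r × Bool`. -/
theorem freeGroup_finite_norm_eq (r n : ℕ) :
    {g : FreeGroup (Fin r) | g.norm = n}.Finite :=
  ((List.finite_length_eq (Fin r × Bool) n).preimage
    FreeGroup.toWord_injective.injOn).subset fun _ hg => hg

/-- The sphere `S_n` of radius `n` in the free group of rank `r`. -/
noncomputable def freeSphere (r n : ℕ) : Finset (FreeGroup (Fin r)) :=
  (freeGroup_finite_norm_eq r n).toFinset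

theorem mem_freeSphere {r n : ℕ} {g : FreeGroup (Fin r)} :
    g ∈ freeSphere r n ↔ g.norm = n := by
  simp [freeSphere]

/-- The sphere average `σ_n(f) = |S_n|⁻¹ ∑_{|g| = n} f ∘ g⁻¹`, that is, the average of `f` along the
action with respect to the uniform probability measure on the sphere of radius `n`. -/
noncomputable def sphereAverage {𝕜 X : Type*} [RCLike 𝕜] {r : ℕ} [MulAction (FreeGroup (Fin r)) X]
    (n : ℕ) (f : X → 𝕜) (x : X) : 𝕜 :=
  ((freeSphere r n).card : 𝕜)⁻¹ * ∑ g ∈ freeSphere r n, f (g⁻¹ • x)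

/-- The σ-algebra of `G`-invariant measurable subsets of `X`. -/
@[reducible]
def invariantSigma (G X : Type*) [Group G] [MulAction G X] [MeasurableSpace X] :
    MeasurableSpace X :=
  ⨅ g : G, MeasurableSpace.invariants (fun x : X => g • x)

theorem measurableSet_invariantSigma {G X : Type*} [Group G] [MulAction G X] [MeasurableSpace X]
    {s : Set X} : MeasurableSet[invariantSigma G X] s ↔
      MeasurableSet s ∧ ∀ g : G, (fun x : X => g • x) ⁻¹' s = s := by
  simp only [MeasurableSpace.measurableSet_iInf,
    MeasurableSpace.measurableSet_invariants]
  exact ⟨fun h => ⟨(h 1).1, fun g => (h g).2⟩, fun h g => ⟨h.1, h.2 g⟩⟩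

theorem invariantSigma_le (G X : Type*) [Group G] [MulAction G X] [m : MeasurableSpace X] :
    invariantSigma G X ≤ m :=
  fun _ hs => (measurableSet_invariantSigma.1 hs).1

/-- `f ∈ L log L (X, μ)`: `f` is (a.e. strongly) measurable and `∫ |f| log⁺ |f| dμ < ∞`, where
`log⁺ t = max 0 (log t)`. -/
def MemLLogL {𝕜 X : Type*} [RCLike 𝕜] [MeasurableSpace X] (f : X → 𝕜) (μ : Measure X) : Prop :=
  AEStronglyMeasurable f μ ∧ Integrable (fun x => ‖f x‖ * Real.posLog ‖f x‖) μ

/-- On a finite measure space `L log L` is contained in `L¹`, so the conditional expectation of an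
`L log L` function is the genuine one. -/
theorem MemLLogL.integrable {𝕜 X : Type*} [RCLike 𝕜] [MeasurableSpace X] {f : X → 𝕜}
    {μ : Measure X} [IsFiniteMeasure μ] (hf : MemLLogL f μ) : Integrable f μ := by
  refine ((integrable_const (Real.exp 1)).add hf.2).mono' hf.1 (ae_of_all _ fun x => ?_)
  simp only [Pi.add_apply]
  rcases le_total ‖f x‖ (Real.exp 1) with h | h
  · have := mul_nonneg (norm_nonneg (f x)) (Real.posLog_nonneg (x := ‖f x‖))
    linarith
  · have h1 : 1 ≤ Real.posLog ‖f x‖ := by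
      refine le_trans ?_ (le_max_right 0 _)
      simpa using Real.log_le_log (Real.exp_pos 1) h
    have := le_mul_of_one_le_right (norm_nonneg (f x)) h1
    linarith [Real.exp_pos 1]

/-! The sphere averages themselves are not powers of one operator on functions on `X`, but they
become so after a letter is recorded. On `X × letters` let `P` be the Markov operator of the
non-backtracking walk `(x, a) ↦ (a⁻¹x, b)`, `b ≠ a⁻¹`. It preserves `μ × counting`, and averaging `P
^ n (f ∘ fst)` over the letter gives `σ_n f` (`sphereAverage_eq_sum_walkOperator`). The claim thus
reduces to Hopf's ergodic theorem for `P` and integrable functions (`tendsto_cesaro`), together with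
an identification of the limit.

Hopf's theorem is proved by a weak-type maximal inequality, obtained from Garsia's argument, and a
dense class: by the mean ergodic theorem in `L²`, functions of the form fixed + coboundary are
dense, and for these convergence is direct.

For the limit, a `P`-fixed `h` in `L²` gives equality in Jensen's inequality, so `h(a⁻¹x, b) = h(x,
a)` for almost every `x` and every admissible `b`. Since `r ≥ 2`, any two letters have a common
admissible predecessor; hence `h` does not depend on the letter and is invariant under the
generators (`aestronglyMeasurable_of_walkOperator_fixed`). -/

/-- A positive unital linear operator on real functions which preserves integrability and the
integral with respect to `m`. -/
structure IsMarkovOperator {Y : Type*} [MeasurableSpace Y] (m : Measure Y)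
    (P : Module.End ℝ (Y → ℝ)) : Prop where
  nonneg : ∀ φ : Y → ℝ, 0 ≤ φ → 0 ≤ P φ
  map_one : P 1 = 1
  integrable : ∀ φ : Y → ℝ, Integrable φ m → Integrable (P φ) m
  integral : ∀ φ : Y → ℝ, Integrable φ m → ∫ y, P φ y ∂m = ∫ y, φ y ∂m

/-! ### Positivity, Jensen's inequality and contraction properties of Markov operators. -/

namespace IsMarkovOperator

variable {Y : Type*} [mY : MeasurableSpace Y] {m : Measure Y} {P : Module.End ℝ (Y → ℝ)}

theorem mono (hP : IsMarkovOperator m P) {φ ψ : Y → ℝ} (h : φ ≤ ψ) : P φ ≤ P ψ := by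
  have := hP.nonneg (ψ - φ) (sub_nonneg.2 h)
  rwa [map_sub, sub_nonneg] at this

theorem map_const (hP : IsMarkovOperator m P) (c : ℝ) : P (fun _ => c) = fun _ => c := by
  have : (fun _ : Y => c) = c • (1 : Y → ℝ) := by ext; simp
  rw [this, map_smul, hP.map_one]

theorem abs_apply_le (hP : IsMarkovOperator m P) (φ : Y → ℝ) : |P φ| ≤ P |φ| := by
  rw [abs_le']
  refine ⟨hP.mono (le_abs_self φ), ?_⟩
  rw [← map_neg]
  exact hP.mono (neg_le_abs φ)

/-- Freeze `c = P φ y` as a constant and apply positivity to `(φ - c)²`: the variance at `y` is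
nonnegative. -/
theorem sq_apply_le (hP : IsMarkovOperator m P) (φ : Y → ℝ) (y : Y) :
    (P φ y) ^ 2 ≤ P (fun z => φ z ^ 2) y := by
  set c := P φ y with hc
  have h := hP.nonneg (fun z => (φ z - c) ^ 2) (fun z => sq_nonneg _) y
  have e : (fun z => (φ z - c) ^ 2) =
      (fun z => φ z ^ 2) - (2 * c) • φ + (fun _ => c ^ 2) := by
    ext z; simp; ring
  rw [e, map_add, map_sub, map_smul, hP.map_const] at h
  simp [← hc] at h
  nlinarith

theorem integral_abs_le (hP : IsMarkovOperator m P) {φ : Y → ℝ} (h : Integrable φ m) :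
    ∫ y, |P φ y| ∂m ≤ ∫ y, |φ y| ∂m := by
  refine (integral_mono (hP.integrable φ h).abs (hP.integrable _ h.abs) (hP.abs_apply_le φ)).trans
    (hP.integral _ h.abs).le

/-- `P` acts on actual functions; the `L¹` contraction bound is what lets it descend to
almost-everywhere classes. -/
theorem congr_ae (hP : IsMarkovOperator m P) {φ ψ : Y → ℝ} (hφ : Integrable φ m)
    (h : φ =ᵐ[m] ψ) : P φ =ᵐ[m] P ψ := by
  have hi : Integrable (φ - ψ) m := hφ.sub (hφ.congr h)
  have h0 : ∫ y, |(φ - ψ) y| ∂m = 0 := by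
    rw [integral_eq_zero_of_ae]
    filter_upwards [h] with y hy
    simp [hy]
  have h1 : ∫ y, |P (φ - ψ) y| ∂m = 0 :=
    le_antisymm ((hP.integral_abs_le hi).trans h0.le) (integral_nonneg fun _ => abs_nonneg _)
  rw [integral_eq_zero_iff_of_nonneg (fun _ => abs_nonneg _) (hP.integrable _ hi).abs] at h1
  filter_upwards [h1] with y hy
  rw [map_sub] at hy
  simpa [sub_eq_zero] using hy

theorem pow (hP : IsMarkovOperator m P) (n : ℕ) : IsMarkovOperator m (P ^ n) := by
  induction n with
  | zero => exact ⟨fun _ h => h, rfl, fun _ h => h, fun _ _ => rfl⟩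
  | succ n ih =>
    rw [pow_succ']
    exact ⟨fun φ h => hP.nonneg _ (ih.nonneg φ h), by simp [ih.map_one, hP.map_one],
      fun φ h => hP.integrable _ (ih.integrable φ h),
      fun φ h => (hP.integral _ (ih.integrable φ h)).trans (ih.integral φ h)⟩

theorem memLp_two [IsFiniteMeasure m] (hP : IsMarkovOperator m P) {φ : Y → ℝ}
    (h : MemLp φ 2 m) : MemLp (P φ) 2 m := by
  have h1 : Integrable φ m := h.integrable (by norm_num)
  have h2 := hP.integrable _ h1
  rw [memLp_two_iff_integrable_sq h2.1]
  refine (hP.integrable _ h.integrable_sq).mono' (h2.1.pow 2) (ae_of_all _ fun y => ?_)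
  rw [Real.norm_of_nonneg (sq_nonneg _)]
  exact hP.sq_apply_le φ y

theorem integral_sq_le [IsFiniteMeasure m] (hP : IsMarkovOperator m P) {φ : Y → ℝ}
    (h : MemLp φ 2 m) : ∫ y, P φ y ^ 2 ∂m ≤ ∫ y, φ y ^ 2 ∂m :=
  (integral_mono (hP.memLp_two h).integrable_sq (hP.integrable _ h.integrable_sq)
    (hP.sq_apply_le φ)).trans (hP.integral _ h.integrable_sq).le

/-! ### The maximal inequality -/

/-- The maximum of `0` and the first `N` partial sums of the orbit of `φ`, in recursive form. -/
noncomputable def maximal (P : Module.End ℝ (Y → ℝ)) (φ : Y → ℝ) : ℕ → Y → ℝ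
  | 0 => 0
  | N + 1 => fun y => max 0 (φ y + P (maximal P φ N) y)

omit mY in
theorem maximal_nonneg (φ : Y → ℝ) (N : ℕ) : 0 ≤ maximal P φ N := by
  cases N with
  | zero => exact le_rfl
  | succ N => exact fun y => le_max_left _ _

theorem maximal_le_succ (hP : IsMarkovOperator m P) (φ : Y → ℝ) (N : ℕ) :
    maximal P φ N ≤ maximal P φ (N + 1) := by
  induction N with
  | zero => exact maximal_nonneg _ _
  | succ N ih =>
    intro y
    exact max_le_max le_rfl (add_le_add le_rfl (hP.mono ih y))

theorem sum_le_maximal (hP : IsMarkovOperator m P) (φ : Y → ℝ) (N : ℕ) :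
    ∑ i ∈ Finset.range N, (P ^ i) φ ≤ maximal P φ N := by
  induction N with
  | zero => simp [maximal]
  | succ N ih =>
    have h : ∑ i ∈ Finset.range (N + 1), (P ^ i) φ
        = φ + P (∑ i ∈ Finset.range N, (P ^ i) φ) := by
      rw [Finset.sum_range_succ', map_sum, add_comm]
      simp [pow_succ']
    rw [h]
    intro y
    exact (add_le_add le_rfl (hP.mono ih y)).trans (le_max_right _ _)

theorem integrable_maximal (hP : IsMarkovOperator m P) {φ : Y → ℝ} (h : Integrable φ m) (N : ℕ) :
    Integrable (maximal P φ N) m := by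
  induction N with
  | zero => exact integrable_zero _ _ _
  | succ N ih => exact (integrable_zero _ _ _).sup (h.add (hP.integrable _ ih))

/-- Garsia's argument. Write `M` for the maximal function. Where `M > 0`, the recursion and
monotonicity in `N` give `M ≤ φ + P M`; elsewhere `M = 0 ≤ P M`. So `M - P M` is at most `φ` cut off
to `{M > 0}`, and its integral is zero. -/
theorem setIntegral_maximal_pos_nonneg (hP : IsMarkovOperator m P) {φ : Y → ℝ}
    (h : Integrable φ m) (N : ℕ) : 0 ≤ ∫ y in {y | 0 < maximal P φ N y}, φ y ∂m := by
  have hM := hP.integrable_maximal h N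
  have hs : NullMeasurableSet {y | 0 < maximal P φ N y} m :=
    nullMeasurableSet_lt aemeasurable_const hM.aemeasurable
  rw [← integral_indicator₀ hs]
  have h0 : ∫ y, (maximal P φ N y - P (maximal P φ N) y) ∂m = 0 := by
    rw [integral_sub hM (hP.integrable _ hM), hP.integral _ hM, sub_self]
  refine h0.symm.le.trans (integral_mono (hM.sub (hP.integrable _ hM)) (h.indicator₀ hs) fun y => ?_)
  by_cases hy : 0 < maximal P φ N y
  · rw [Set.indicator_of_mem (by exact hy)]
    cases N with
    | zero => simp [maximal] at hy
    | succ N =>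
      have h1 := hP.mono (hP.maximal_le_succ φ N) y
      have h2 : maximal P φ (N + 1) y = φ y + P (maximal P φ N) y := by
        simp only [maximal] at hy ⊢
        exact max_eq_right ((lt_max_iff.1 hy).resolve_left (lt_irrefl _)).le
      show maximal P φ (N + 1) y - P (maximal P φ (N + 1)) y ≤ φ y
      linarith
  · rw [Set.indicator_of_notMem (by exact hy)]
    have h1 := hP.nonneg _ (maximal_nonneg (P := P) φ N) y
    simp only [Pi.zero_apply] at h1
    show maximal P φ N y - P (maximal P φ N) y ≤ 0
    linarith [not_lt.1 hy]

/-- The averages `(n + 1)⁻¹ ∑ i ≤ n, P ^ i φ`. -/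
noncomputable def cesaro (P : Module.End ℝ (Y → ℝ)) (n : ℕ) : Module.End ℝ (Y → ℝ) :=
  ((n : ℝ) + 1)⁻¹ • ∑ i ∈ Finset.range (n + 1), P ^ i

omit mY in
theorem cesaro_apply (n : ℕ) (φ : Y → ℝ) (y : Y) :
    cesaro P n φ y = ((n : ℝ) + 1)⁻¹ * ∑ i ∈ Finset.range (n + 1), (P ^ i) φ y := by
  simp [cesaro]

theorem abs_cesaro_le (hP : IsMarkovOperator m P) (n : ℕ) (φ : Y → ℝ) (y : Y) :
    |cesaro P n φ y| ≤ cesaro P n |φ| y := by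
  rw [cesaro_apply, cesaro_apply, abs_mul, abs_of_pos (by positivity : (0 : ℝ) < ((n : ℝ) + 1)⁻¹)]
  gcongr
  exact (Finset.abs_sum_le_sum_abs _ _).trans
    (Finset.sum_le_sum fun i _ => (hP.pow i).abs_apply_le φ y)

theorem measure_exists_lt_cesaro_le [IsFiniteMeasure m] (hP : IsMarkovOperator m P) {φ : Y → ℝ}
    (h : Integrable φ m) {c : ℝ} (hc : 0 < c) :
    m {y | ∃ n, c < cesaro P n |φ| y} ≤ ENNReal.ofReal ((∫ y, |φ y| ∂m) / c) := by
  -- As `P` fixes constants, an average of `|φ|` exceeds `c` exactly when the corresponding partial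
  -- sum for `ψ` is positive.
  set ψ : Y → ℝ := |φ| - fun _ => c with hψ
  have hψi : Integrable ψ m := h.abs.sub (integrable_const c)
  have hmono : Monotone fun N => {y | 0 < maximal P ψ N y} :=
    monotone_nat_of_le_succ fun N y hy => lt_of_lt_of_le hy (hP.maximal_le_succ ψ N y)
  have hsub : {y | ∃ n, c < cesaro P n |φ| y} ⊆ ⋃ N, {y | 0 < maximal P ψ N y} := by
    rintro y ⟨n, hn⟩
    refine Set.mem_iUnion.2 ⟨n + 1, lt_of_lt_of_le ?_ (hP.sum_le_maximal ψ (n + 1) y)⟩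
    have hpos : (0 : ℝ) < (n : ℝ) + 1 := by positivity
    rw [cesaro_apply, inv_mul_eq_div, lt_div_iff₀ hpos] at hn
    have : ∀ i, (P ^ i) ψ y = (P ^ i) |φ| y - c := fun i => by
      rw [hψ, map_sub, (hP.pow i).map_const]; rfl
    simp only [Finset.sum_apply, this, Finset.sum_sub_distrib, Finset.sum_const,
      Finset.card_range, nsmul_eq_mul]
    push_cast
    linarith
  refine (measure_mono hsub).trans ?_
  rw [hmono.measure_iUnion]
  refine iSup_le fun N => ?_
  have hs : NullMeasurableSet {y | 0 < maximal P ψ N y} m :=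
    nullMeasurableSet_lt aemeasurable_const (hP.integrable_maximal hψi N).aemeasurable
  have h1 := hP.setIntegral_maximal_pos_nonneg hψi N
  have h2 : ∫ y in {y | 0 < maximal P ψ N y}, ψ y ∂m
      = ∫ y in {y | 0 < maximal P ψ N y}, |φ y| ∂m - m.real {y | 0 < maximal P ψ N y} * c := by
    simp only [hψ, Pi.sub_apply, Pi.abs_apply]
    rw [integral_sub h.abs.integrableOn (integrable_const c).integrableOn]
    simp
  have h3 : ∫ y in {y | 0 < maximal P ψ N y}, |φ y| ∂m ≤ ∫ y, |φ y| ∂m :=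
    setIntegral_le_integral h.abs (ae_of_all _ fun _ => abs_nonneg _)
  rw [← ofReal_measureReal]
  refine ENNReal.ofReal_le_ofReal ?_
  rw [le_div_iff₀ hc]
  linarith

end IsMarkovOperator

namespace IsMarkovOperator

variable {Y : Type*} {J : MeasurableSpace Y} [mY : MeasurableSpace Y] {m : Measure Y} {P : Module.End ℝ (Y → ℝ)}

/-! ### Almost everywhere convergence of the averages -/

/-- The set of functions whose averages converge almost everywhere to the conditional expectation
is closed in `L¹`. -/
theorem tendsto_cesaro_of_approx [IsFiniteMeasure m] (hP : IsMarkovOperator m P) {φ : Y → ℝ} (hφ : Integrable φ m)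
    (H : ∀ ε > 0, ∃ γ : Y → ℝ, Integrable γ m ∧ ∫ y, |(φ - γ) y| ∂m ≤ ε ∧
      ∀ᵐ y ∂m, Tendsto (fun n => cesaro P n γ y) atTop (𝓝 ((m[γ | J]) y))) :
    ∀ᵐ y ∂m, Tendsto (fun n => cesaro P n φ y) atTop (𝓝 ((m[φ | J]) y)) := by
  -- One `c` each for the averages of `φ - γ`, the convergence for `γ`, and the conditional
  -- expectation of `φ - γ`.
  have key : ∀ c : ℝ, 0 < c → ∀ᵐ y ∂m, ∀ᶠ n in atTop,
      |cesaro P n φ y - (m[φ | J]) y| ≤ 3 * c := by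
    intro c hc
    rw [ae_iff]
    refine le_antisymm (ENNReal.le_of_forall_pos_le_add fun ε hε _ => ?_) bot_le
    -- Two weak-type bounds, each dividing the `L¹` error by `c`, contribute `ε / 2` apiece.
    obtain ⟨γ, hγ, hγε, hγt⟩ := H (ε * c / 2) (by positivity)
    have hδ : Integrable (φ - γ) m := hφ.sub hγ
    have hE := condExp_sub hφ hγ J
    have h1 := hP.measure_exists_lt_cesaro_le hδ hc
    have h2 : m {y | c ≤ |(m[φ - γ | J]) y|} ≤ ENNReal.ofReal ((∫ y, |(φ - γ) y| ∂m) / c) := by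
      have h := mul_meas_ge_le_integral_of_nonneg
        (ae_of_all m fun y => abs_nonneg ((m[φ - γ | J]) y)) integrable_condExp.abs c
      have h' := h.trans (integral_abs_condExp_le (m := J) (μ := m) (φ - γ))
      rw [← ofReal_measureReal]
      refine ENNReal.ofReal_le_ofReal ?_
      rw [le_div_iff₀ hc, mul_comm]
      exact h'
    have h3 : ENNReal.ofReal ((∫ y, |(φ - γ) y| ∂m) / c) ≤ ENNReal.ofReal (ε / 2) := by
      refine ENNReal.ofReal_le_ofReal ?_
      rw [div_le_iff₀ hc]
      linarith
    have hN : m {y | ¬ (Tendsto (fun n => cesaro P n γ y) atTop (𝓝 ((m[γ | J]) y)) ∧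
        (m[φ - γ | J]) y = (m[φ | J] - m[γ | J]) y)} = 0 := ae_iff.1 (hγt.and hE)
    have hsub : {y | ¬ ∀ᶠ n in atTop, |cesaro P n φ y - (m[φ | J]) y| ≤ 3 * c} ⊆
        {y | ¬ (Tendsto (fun n => cesaro P n γ y) atTop (𝓝 ((m[γ | J]) y)) ∧
        (m[φ - γ | J]) y = (m[φ | J] - m[γ | J]) y)} ∪
        ({y | ∃ n, c < cesaro P n |φ - γ| y} ∪ {y | c ≤ |(m[φ - γ | J]) y|}) := by
      intro y hy
      by_contra hcon
      simp only [Set.mem_union, Set.mem_ofPred_eq, not_or, not_not, not_exists, not_lt,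
        not_le] at hcon hy
      obtain ⟨⟨ht, he⟩, hm, hcE⟩ := hcon
      apply hy
      have := (Metric.tendsto_nhds.1 ht) c hc
      filter_upwards [this] with n hn
      rw [Real.dist_eq] at hn
      have hA := (hP.abs_cesaro_le n (φ - γ) y).trans (hm n)
      rw [map_sub] at hA
      simp only [Pi.sub_apply] at hA he
      rw [he] at hcE
      rw [abs_le] at hA ⊢
      rw [abs_lt] at hn hcE
      constructor <;> linarith [hA.1, hA.2, hn.1, hn.2, hcE.1, hcE.2]
    calc _ ≤ _ := measure_mono hsub
      _ ≤ _ := measure_union_le _ _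
      _ ≤ 0 + (ENNReal.ofReal (ε / 2) + ENNReal.ofReal (ε / 2)) := by
        refine add_le_add hN.le ((measure_union_le _ _).trans (add_le_add ?_ ?_))
        · exact h1.trans h3
        · exact h2.trans h3
      _ = 0 + ε := by
        rw [← ENNReal.ofReal_add (by positivity) (by positivity), add_halves,
          ENNReal.ofReal_coe_nnreal]
  have key' : ∀ k : ℕ, ∀ᵐ y ∂m, ∀ᶠ n in atTop,
      |cesaro P n φ y - (m[φ | J]) y| ≤ 3 * (1 / ((k : ℝ) + 1)) :=
    fun k => key _ Nat.one_div_pos_of_nat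
  filter_upwards [ae_all_iff.2 key'] with y hy
  rw [Metric.tendsto_nhds]
  intro ε hε
  obtain ⟨k, hk⟩ := exists_nat_one_div_lt (show (0 : ℝ) < ε / 3 by positivity)
  filter_upwards [hy k] with n hn
  rw [Real.dist_eq]
  linarith

theorem tendsto_cesaro_of_fixed [IsFiniteMeasure m] (hP : IsMarkovOperator m P) (hJ : J ≤ mY) {φ : Y → ℝ} (hφ : Integrable φ m)
    (hfix : P φ =ᵐ[m] φ) (hm : AEStronglyMeasurable[J] φ m) :
    ∀ᵐ y ∂m, Tendsto (fun n => cesaro P n φ y) atTop (𝓝 ((m[φ | J]) y)) := by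
  have hi : ∀ i : ℕ, (P ^ i) φ =ᵐ[m] φ := by
    intro i
    induction i with
    | zero => rfl
    | succ i ih =>
      rw [pow_succ']
      exact (hP.congr_ae ((hP.pow i).integrable φ hφ) ih).trans hfix
  filter_upwards [ae_all_iff.2 hi, condExp_of_aestronglyMeasurable' hJ hm hφ] with y hy he
  rw [he]
  refine tendsto_const_nhds.congr fun n => ?_
  rw [cesaro_apply, Finset.sum_congr rfl fun i _ => hy i]
  have : (n : ℝ) + 1 ≠ 0 := by positivity
  simp
  field_simp

omit mY in
theorem cesaro_sub_apply (n : ℕ) (g : Y → ℝ) (y : Y) :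
    cesaro P n (g - P g) y = ((n : ℝ) + 1)⁻¹ * (g y - (P ^ (n + 1)) g y) := by
  rw [cesaro_apply]
  congr 1
  have : ∀ i, (P ^ i) (g - P g) y = (P ^ i) g y - (P ^ (i + 1)) g y := fun i => by
    rw [map_sub, pow_succ]; rfl
  simp only [this]
  rw [Finset.sum_range_sub']
  simp

theorem condExp_sub_ae_eq_zero [IsFiniteMeasure m] (hP : IsMarkovOperator m P) (hJ : J ≤ mY)
    (hinv : ∀ C, MeasurableSet[J] C → ∀ g : Y → ℝ, Integrable g m →
      ∫ y in C, P g y ∂m = ∫ y in C, g y ∂m) {g : Y → ℝ} (hg : Integrable g m) :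
    m[g - P g | J] =ᵐ[m] 0 := by
  have hPg := hP.integrable _ hg
  refine (ae_eq_condExp_of_forall_setIntegral_eq hJ (hg.sub hPg)
    (fun _ _ _ => (integrable_zero _ _ _).integrableOn) (fun C hC _ => ?_)
    aestronglyMeasurable_zero).symm
  simp only [Pi.sub_apply, Pi.zero_apply]
  rw [integral_sub hg.integrableOn hPg.integrableOn, hinv C hC g hg]
  simp

/-- For bounded `g` the sum telescopes to a bounded quantity divided by `n + 1`. A general `g` is
approximated by simple functions; passing to the coboundary at most doubles the `L¹` error, hence
the `ε / 2`. -/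
theorem tendsto_cesaro_sub [IsFiniteMeasure m] (hP : IsMarkovOperator m P) (hJ : J ≤ mY)
    (hinv : ∀ C, MeasurableSet[J] C → ∀ g : Y → ℝ, Integrable g m →
      ∫ y in C, P g y ∂m = ∫ y in C, g y ∂m) {g : Y → ℝ} (hg : Integrable g m) :
    ∀ᵐ y ∂m, Tendsto (fun n => cesaro P n (g - P g) y) atTop (𝓝 ((m[g - P g | J]) y)) := by
  refine hP.tendsto_cesaro_of_approx (hg.sub (hP.integrable _ hg)) fun ε hε => ?_
  obtain ⟨s, hs, -⟩ := (memLp_one_iff_integrable.2 hg).exists_simpleFunc_eLpNorm_sub_lt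
    ENNReal.one_ne_top (ε := ENNReal.ofReal (ε / 2)) (by simpa using hε)
  have hsi : Integrable s m := s.integrable_of_isFiniteMeasure
  have hgs : Integrable (g - ⇑s) m := hg.sub hsi
  have hs' : ∫ y, |(g - ⇑s) y| ∂m ≤ ε / 2 := by
    rw [eLpNorm_one_eq_lintegral_enorm, ← ofReal_integral_norm_eq_lintegral_enorm hgs,
      ENNReal.ofReal_lt_ofReal_iff (by positivity)] at hs
    exact hs.le
  refine ⟨⇑s - P ⇑s, hsi.sub (hP.integrable _ hsi), ?_, ?_⟩
  · have e : (g - P g) - (⇑s - P ⇑s) = (g - ⇑s) - P (g - ⇑s) := by rw [map_sub]; abel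
    rw [e]
    have h1 : ∫ y, |((g - ⇑s) - P (g - ⇑s)) y| ∂m ≤
        ∫ y, (|(g - ⇑s) y| + |P (g - ⇑s) y|) ∂m :=
      integral_mono (hgs.sub (hP.integrable _ hgs)).abs
        (hgs.abs.add (hP.integrable _ hgs).abs) fun y => abs_sub _ _
    rw [integral_add hgs.abs (hP.integrable _ hgs).abs] at h1
    linarith [hP.integral_abs_le hgs]
  · obtain ⟨C, hC⟩ := s.exists_forall_norm_le
    filter_upwards [hP.condExp_sub_ae_eq_zero hJ hinv hsi] with y hy
    rw [hy]
    have hb : ∀ n, |(P ^ n) s y| ≤ C := fun n => by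
      refine ((hP.pow n).abs_apply_le s y).trans ?_
      have := (hP.pow n).mono (φ := |⇑s|) (ψ := fun _ => C) (fun z => hC z) y
      rwa [(hP.pow n).map_const] at this
    have h0 : Tendsto (fun n : ℕ => ((n : ℝ) + 1)⁻¹ * (2 * C)) atTop (𝓝 0) := by
      have := (tendsto_one_div_add_atTop_nhds_zero_nat (𝕜 := ℝ)).mul_const (2 * C)
      simpa using this
    refine squeeze_zero_norm (fun n => ?_) h0
    rw [cesaro_sub_apply, norm_mul, Real.norm_of_nonneg (by positivity)]
    gcongr
    refine (abs_sub _ _).trans ?_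
    linarith [hb 0, hb (n + 1), show |(P ^ 0) s y| = |s y| from rfl]

/-! ### The mean ergodic theorem in `L²` and Hopf's theorem. -/

theorem integral_sq_coe_Lp (z : Lp ℝ 2 m) : ∫ y, z y ^ 2 ∂m = ‖z‖ ^ 2 := by
  rw [← real_inner_self_eq_norm_sq, L2.inner_def]
  exact integral_congr_ae (ae_of_all _ fun y => by simp [sq])

/-- The operator induced on `L²` by a Markov operator. -/
noncomputable def toLpTwo [IsFiniteMeasure m] (hP : IsMarkovOperator m P) :
    Lp ℝ 2 m →L[ℝ] Lp ℝ 2 m :=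
  LinearMap.mkContinuous
    { toFun := fun z => (hP.memLp_two (Lp.memLp z)).toLp (P z)
      map_add' := fun z w => by
        rw [← MemLp.toLp_add, MemLp.toLp_eq_toLp_iff, ← map_add]
        exact hP.congr_ae ((Lp.memLp _).integrable (by norm_num)) (Lp.coeFn_add z w)
      map_smul' := fun c z => by
        rw [RingHom.id_apply, ← MemLp.toLp_const_smul, MemLp.toLp_eq_toLp_iff, ← map_smul]
        exact hP.congr_ae ((Lp.memLp _).integrable (by norm_num)) (Lp.coeFn_smul c z) } 1
    fun z => by
      rw [one_mul]
      refine le_of_sq_le_sq ?_ (norm_nonneg _)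
      rw [← integral_sq_coe_Lp, ← integral_sq_coe_Lp]
      refine (integral_congr_ae ?_).trans_le (hP.integral_sq_le (Lp.memLp z))
      filter_upwards [(hP.memLp_two (Lp.memLp z)).coeFn_toLp] with y hy
      exact congrArg (· ^ 2) hy

theorem coeFn_toLpTwo [IsFiniteMeasure m] (hP : IsMarkovOperator m P) (z : Lp ℝ 2 m) :
    hP.toLpTwo z =ᵐ[m] P z :=
  (hP.memLp_two (Lp.memLp z)).coeFn_toLp

theorem norm_toLpTwo_le [IsFiniteMeasure m] (hP : IsMarkovOperator m P) : ‖hP.toLpTwo‖ ≤ 1 :=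
  LinearMap.mkContinuous_norm_le _ zero_le_one _

theorem _root_.ContinuousLinearMap.sub_birkhoffAverage_mem_range {E : Type*}
    [NormedAddCommGroup E] [NormedSpace ℝ E] (T : E →L[ℝ] E) (x : E) {n : ℕ} (hn : n ≠ 0) :
    ∃ u, x - birkhoffAverage ℝ T _root_.id n x = u - T u := by
  have hi : ∀ i : ℕ, x - T^[i] x ∈ LinearMap.range (LinearMap.id - (T : E →ₗ[ℝ] E) : E →ₗ[ℝ] E) := by
    intro i
    induction i with
    | zero => simp
    | succ i ih =>
      have : x - T^[i + 1] x = (x - T^[i] x) + (LinearMap.id - (T : E →ₗ[ℝ] E) : E →ₗ[ℝ] E) (T^[i] x) := by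
        simp [Function.iterate_succ_apply']
      rw [this]
      exact add_mem ih (LinearMap.mem_range_self _ _)
  have hs := Submodule.smul_mem _ ((n : ℝ)⁻¹)
    (Submodule.sum_mem _ fun i (_ : i ∈ Finset.range n) => hi i)
  obtain ⟨u, hu⟩ := hs
  refine ⟨u, ?_⟩
  have h2 : (LinearMap.id - (T : E →ₗ[ℝ] E) : E →ₗ[ℝ] E) u = u - T u := by simp
  rw [← h2, hu, Finset.sum_sub_distrib, smul_sub, birkhoffAverage, birkhoffSum]
  congr 1
  simp only [Finset.sum_const, Finset.card_range]
  rw [← Nat.cast_smul_eq_nsmul ℝ, smul_smul, inv_mul_cancel₀ (by exact_mod_cast hn), one_smul]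

/-- By von Neumann's theorem the averages of `x` tend to a fixed vector `p`. As `x` minus an average
is exactly a coboundary, the only error is the average minus `p`, which is small in `L²`. -/
theorem exists_fixed_add_coboundary [IsFiniteMeasure m] (hP : IsMarkovOperator m P) {φ : Y → ℝ}
    (hφ : MemLp φ 2 m) {ε : ℝ} (hε : 0 < ε) :
    ∃ h g : Y → ℝ, MemLp h 2 m ∧ MemLp g 2 m ∧ P h =ᵐ[m] h ∧
      ∫ y, |(φ - (h + (g - P g))) y| ∂m ≤ ε := by
  set T := hP.toLpTwo
  set x := hφ.toLp φ
  obtain ⟨p, hp, hlim⟩ : ∃ p, T p = p ∧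
      Tendsto (birkhoffAverage ℝ T _root_.id · x) atTop (𝓝 p) :=
    ⟨_, ((T.eqLocus (1 : Lp ℝ 2 m →L[ℝ] Lp ℝ 2 m)).orthogonalProjectionOnto x).2,
      T.tendsto_birkhoffAverage_orthogonalProjection hP.norm_toLpTwo_le x⟩
  -- With `η = ε / K` the final bound is `η * m(Y) + η⁻¹ * η² = η * K = ε`.
  set K : ℝ := m.real Set.univ + 1 with hK
  have hK0 : 0 < K := by positivity
  obtain ⟨n, hn, hn0⟩ := ((Metric.tendsto_nhds.1 hlim (ε / K) (by positivity)).and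
    (eventually_ne_atTop 0)).exists
  obtain ⟨u, hu⟩ := T.sub_birkhoffAverage_mem_range x hn0
  set z : Lp ℝ 2 m := birkhoffAverage ℝ T _root_.id n x - p with hz
  have hzn : ‖z‖ < ε / K := by rwa [dist_eq_norm] at hn
  refine ⟨p, u, Lp.memLp p, Lp.memLp u, ?_, ?_⟩
  · exact (hP.coeFn_toLpTwo p).symm.trans (by rw [show hP.toLpTwo p = p from hp])
  have hxz : x - (p + (u - T u)) = z := by rw [← hu, hz]; abel
  have hae : φ - (⇑p + (⇑u - P ⇑u)) =ᵐ[m] z := by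
    rw [← hxz]
    filter_upwards [hφ.coeFn_toLp, Lp.coeFn_sub x (p + (u - T u)), Lp.coeFn_add p (u - T u),
      Lp.coeFn_sub u (T u), hP.coeFn_toLpTwo u] with y h1 h2 h3 h4 h5
    simp only [Pi.sub_apply, Pi.add_apply] at h2 h3 h4 ⊢
    rw [h2, h3, h4, h5, h1]
  have hzi : Integrable z m := (Lp.memLp z).integrable (by norm_num)
  have hzs : Integrable (fun y => z y ^ 2) m := (Lp.memLp z).integrable_sq
  set η := ε / K with hη
  have hη0 : 0 < η := by positivity
  calc ∫ y, |(φ - (⇑p + (⇑u - P ⇑u))) y| ∂m = ∫ y, |z y| ∂m := by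
        refine integral_congr_ae ?_
        filter_upwards [hae] with y hy
        rw [hy]
    _ ≤ ∫ y, (η + η⁻¹ * z y ^ 2) ∂m := by
        refine integral_mono hzi.abs ((integrable_const _).add (hzs.const_mul _)) fun y => ?_
        -- The pointwise inequality `2|z| ≤ η + η⁻¹z²` replaces Cauchy–Schwarz in passing from `L²`
        -- to `L¹`.
        have : 0 ≤ η⁻¹ * (|z y| - η) ^ 2 := by positivity
        have e : η⁻¹ * (|z y| - η) ^ 2 = η + η⁻¹ * z y ^ 2 - 2 * |z y| := by
          rw [sub_sq, sq_abs]
          field_simp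
          ring
        show |z y| ≤ _
        linarith [abs_nonneg (z y)]
    _ = η * m.real Set.univ + η⁻¹ * ‖z‖ ^ 2 := by
        rw [integral_add (integrable_const _) (hzs.const_mul _), integral_const_mul,
          integral_sq_coe_Lp]
        simp [mul_comm]
    _ ≤ η * m.real Set.univ + η⁻¹ * η ^ 2 := by gcongr
    _ = ε := by
        have : η * K = ε := by rw [hη]; field_simp
        rw [← this, hK]
        field_simp

/-- **Hopf's pointwise ergodic theorem** for a Markov operator `P` on a finite measure space: the
averages of the orbit of an integrable function converge almost everywhere to the conditional
expectation on a `P`-invariant σ-algebra for which the `P`-fixed functions are measurable. -/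
theorem tendsto_cesaro [IsFiniteMeasure m] (hP : IsMarkovOperator m P) (hJ : J ≤ mY)
    (hinv : ∀ C, MeasurableSet[J] C → ∀ g : Y → ℝ, Integrable g m →
      ∫ y in C, P g y ∂m = ∫ y in C, g y ∂m)
    (hfix : ∀ h : Y → ℝ, MemLp h 2 m → P h =ᵐ[m] h → AEStronglyMeasurable[J] h m)
    {φ : Y → ℝ} (hφ : Integrable φ m) :
    ∀ᵐ y ∂m, Tendsto (fun n => cesaro P n φ y) atTop (𝓝 ((m[φ | J]) y)) := by
  refine hP.tendsto_cesaro_of_approx hφ fun ε hε => ?_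
  -- A simple function lies in `L²`, so the splitting applies to it.
  obtain ⟨s, hs, -⟩ := (memLp_one_iff_integrable.2 hφ).exists_simpleFunc_eLpNorm_sub_lt
    ENNReal.one_ne_top (ε := ENNReal.ofReal (ε / 2)) (by simpa using hε)
  have hsi : Integrable s m := s.integrable_of_isFiniteMeasure
  have hφs : Integrable (φ - ⇑s) m := hφ.sub hsi
  have hs' : ∫ y, |(φ - ⇑s) y| ∂m ≤ ε / 2 := by
    rw [eLpNorm_one_eq_lintegral_enorm, ← ofReal_integral_norm_eq_lintegral_enorm hφs,
      ENNReal.ofReal_lt_ofReal_iff (by positivity)] at hs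
    exact hs.le
  obtain ⟨h, g, hh, hg, hPh, hhg⟩ := hP.exists_fixed_add_coboundary
    (s.memLp_of_isFiniteMeasure 2 m) (half_pos hε)
  have hhi : Integrable h m := hh.integrable (by norm_num)
  have hgi : Integrable g m := hg.integrable (by norm_num)
  have hci : Integrable (g - P g) m := hgi.sub (hP.integrable _ hgi)
  refine ⟨h + (g - P g), hhi.add hci, ?_, ?_⟩
  · have hsc : Integrable (⇑s - (h + (g - P g))) m := hsi.sub (hhi.add hci)
    have h1 : ∫ y, |(φ - (h + (g - P g))) y| ∂m ≤
        ∫ y, (|(φ - ⇑s) y| + |(⇑s - (h + (g - P g))) y|) ∂m :=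
      integral_mono (hφ.sub (hhi.add hci)).abs (hφs.abs.add hsc.abs) fun y => by
        have := abs_add_le ((φ - ⇑s) y) ((⇑s - (h + (g - P g))) y)
        simpa using this
    rw [integral_add hφs.abs hsc.abs] at h1
    linarith
  · filter_upwards [hP.tendsto_cesaro_of_fixed hJ hhi hPh (hfix h hh hPh),
      hP.tendsto_cesaro_sub hJ hinv hgi, condExp_add hhi hci J] with y h1 h2 h3
    rw [h3]
    simpa using h1.add h2

end IsMarkovOperator

/-! ### The equality case of Jensen's inequality. -/

theorem IsMarkovOperator.apply_sq_sub_ae_eq_zero {Y : Type*} [MeasurableSpace Y] {m : Measure Y}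
    [IsFiniteMeasure m] {P : Module.End ℝ (Y → ℝ)} (hP : IsMarkovOperator m P) {h : Y → ℝ}
    (hh : MemLp h 2 m) (hfix : P h =ᵐ[m] h) :
    ∀ᵐ y ∂m, P (fun z => (h z - h y) ^ 2) y = 0 := by
  have hi : Integrable (fun y => P h y ^ 2) m := (hP.memLp_two hh).integrable_sq
  have hi' := hP.integrable _ hh.integrable_sq
  have h0 : ∫ y, (P (fun z => h z ^ 2) y - P h y ^ 2) ∂m = 0 := by
    rw [integral_sub hi' hi, hP.integral _ hh.integrable_sq, sub_eq_zero]
    refine integral_congr_ae ?_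
    filter_upwards [hfix] with y hy
    rw [hy]
  rw [integral_eq_zero_iff_of_nonneg (fun y => sub_nonneg.2 (hP.sq_apply_le h y))
    (hi'.sub hi)] at h0
  filter_upwards [h0, hfix] with y hy hf
  have e : (fun z => (h z - h y) ^ 2) =
      (fun z => h z ^ 2) - (2 * h y) • h + (fun _ => h y ^ 2) := by
    ext z; simp; ring
  rw [e, map_add, map_sub, map_smul, hP.map_const]
  simp only [Pi.zero_apply, hf] at hy
  simp only [Pi.add_apply, Pi.sub_apply, Pi.smul_apply, smul_eq_mul, hf]
  linarith

/-! ### Reduced words -/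

/-- The inverse of a letter of the free group. -/
def letterInv {r : ℕ} (a : Fin r × Bool) : Fin r × Bool := (a.1, !a.2)

theorem letterInv_involutive {r : ℕ} : Function.Involutive (letterInv (r := r)) := fun a => by
  simp [letterInv]

theorem ne_letterInv_iff {r : ℕ} {a b : Fin r × Bool} :
    b ≠ letterInv a ↔ (a.1 = b.1 → a.2 = b.2) := by
  obtain ⟨i, s⟩ := a
  obtain ⟨j, t⟩ := b
  simp only [letterInv, ne_eq, Prod.mk.injEq, not_and]
  constructor
  · intro h e
    have := h e.symm
    revert this
    cases s <;> cases t <;> simp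
  · intro h e
    have := h e.symm
    revert this
    cases s <;> cases t <;> simp

/-- The words `L` of length `n` for which `a :: L` is reduced. -/
def reducedTails {r : ℕ} : ℕ → Fin r × Bool → Finset (List (Fin r × Bool))
  | 0, _ => {[]}
  | n + 1, a => (Finset.univ.erase (letterInv a)).biUnion fun b =>
      (reducedTails n b).image (List.cons b)

theorem mem_reducedTails {r n : ℕ} {a : Fin r × Bool} {L : List (Fin r × Bool)} :
    L ∈ reducedTails n a ↔ L.length = n ∧ FreeGroup.IsReduced (a :: L) := by
  induction n generalizing a L with
  | zero =>
    simp only [reducedTails, Finset.mem_singleton, List.length_eq_zero_iff]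
    exact ⟨fun h => ⟨h, h ▸ FreeGroup.IsReduced.singleton⟩, fun h => h.1⟩
  | succ n ih =>
    simp only [reducedTails, Finset.mem_biUnion, Finset.mem_erase, Finset.mem_univ, and_true,
      Finset.mem_image, ih, ne_letterInv_iff]
    constructor
    · rintro ⟨b, hb, L', ⟨hl, hr⟩, rfl⟩
      exact ⟨by simp [hl], FreeGroup.isReduced_cons_cons.2 ⟨hb, hr⟩⟩
    · rintro ⟨hl, hr⟩
      cases L with
      | nil => simp at hl
      | cons b L' =>
        obtain ⟨hb, hr'⟩ := FreeGroup.isReduced_cons_cons.1 hr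
        exact ⟨b, hb, L', ⟨by simpa using hl, hr'⟩, rfl⟩

theorem sum_biUnion_image_cons {α M : Type*} [DecidableEq α] [AddCommMonoid M] (s : Finset α)
    (t : α → Finset (List α)) (F : List α → M) :
    ∑ L ∈ s.biUnion (fun b => (t b).image (List.cons b)), F L =
      ∑ b ∈ s, ∑ L ∈ t b, F (b :: L) := by
  rw [Finset.sum_biUnion]
  · exact Finset.sum_congr rfl fun b _ =>
      Finset.sum_image fun _ _ _ _ h => List.cons_injective h
  · intro b _ c _ hbc
    simp only [Function.onFun, Finset.disjoint_left, Finset.mem_image]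
    rintro _ ⟨L, _, rfl⟩ ⟨L', _, h⟩
    exact hbc (List.cons.inj h).1.symm

theorem sum_freeSphere_succ {r n : ℕ} {M : Type*} [AddCommMonoid M]
    (F : FreeGroup (Fin r) → M) :
    ∑ g ∈ freeSphere r (n + 1), F g =
      ∑ a : Fin r × Bool, ∑ L ∈ reducedTails n a, F (FreeGroup.mk (a :: L)) := by
  rw [← sum_biUnion_image_cons Finset.univ (reducedTails n) fun L => F (FreeGroup.mk L)]
  refine Finset.sum_nbij' FreeGroup.toWord FreeGroup.mk (fun g hg => ?_) (fun L hL => ?_)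
    (fun g _ => FreeGroup.mk_toWord) (fun L hL => ?_) (fun g _ => by rw [FreeGroup.mk_toWord])
  · rw [mem_freeSphere, FreeGroup.norm] at hg
    have hr := FreeGroup.isReduced_toWord (x := g)
    simp only [Finset.mem_biUnion, Finset.mem_univ, true_and, Finset.mem_image, mem_reducedTails]
    cases h : g.toWord with
    | nil => simp [h] at hg
    | cons a L =>
      rw [h] at hg hr
      exact ⟨a, L, ⟨by simpa using hg, hr⟩, rfl⟩
  · simp only [Finset.mem_biUnion, Finset.mem_univ, true_and, Finset.mem_image,
      mem_reducedTails] at hL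
    obtain ⟨a, L, ⟨hl, hr⟩, rfl⟩ := hL
    rw [mem_freeSphere, FreeGroup.norm, FreeGroup.toWord_mk, hr.reduce_eq]
    simp [hl]
  · simp only [Finset.mem_biUnion, Finset.mem_univ, true_and, Finset.mem_image,
      mem_reducedTails] at hL
    obtain ⟨a, L, ⟨hl, hr⟩, rfl⟩ := hL
    rw [FreeGroup.toWord_mk, hr.reduce_eq]

/-! ### The operator of the non-backtracking walk -/

section Walk

variable {r : ℕ} {X : Type*} [MulAction (FreeGroup (Fin r)) X]

/-- The Markov operator of the non-backtracking walk: from `(x, a)` one moves to `(a⁻¹ x, b)`, with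
`b` uniformly distributed among the letters other than `a⁻¹`. -/
noncomputable def walkOperator (r : ℕ) (X : Type*) [MulAction (FreeGroup (Fin r)) X] :
    Module.End ℝ (X × (Fin r × Bool) → ℝ) where
  toFun φ y := (2 * (r : ℝ) - 1)⁻¹ *
    ∑ b ∈ Finset.univ.erase (letterInv y.2), φ ((FreeGroup.mk [y.2])⁻¹ • y.1, b)
  map_add' φ ψ := by
    ext y
    simp [Finset.sum_add_distrib, mul_add]
  map_smul' c φ := by
    ext y
    simp only [Pi.smul_apply, smul_eq_mul, RingHom.id_apply, ← Finset.mul_sum]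
    ring

theorem walkOperator_apply (φ : X × (Fin r × Bool) → ℝ) (x : X) (a : Fin r × Bool) :
    walkOperator r X φ (x, a) = (2 * (r : ℝ) - 1)⁻¹ *
      ∑ b ∈ Finset.univ.erase (letterInv a), φ ((FreeGroup.mk [a])⁻¹ • x, b) :=
  rfl

theorem card_erase_letterInv (hr : 1 ≤ r) (a : Fin r × Bool) :
    ((Finset.univ.erase (letterInv a)).card : ℝ) = 2 * (r : ℝ) - 1 := by
  rw [Finset.card_erase_of_mem (Finset.mem_univ _), Finset.card_univ, Fintype.card_prod,
    Fintype.card_fin, Fintype.card_bool, Nat.cast_sub (by omega)]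
  push_cast
  ring

theorem two_mul_sub_one_pos (hr : 1 ≤ r) : (0 : ℝ) < 2 * (r : ℝ) - 1 := by
  have : (1 : ℝ) ≤ r := by exact_mod_cast hr
  linarith

theorem walkOperator_one (hr : 1 ≤ r) : walkOperator r X 1 = 1 := by
  ext ⟨x, a⟩
  rw [walkOperator_apply]
  simp only [Pi.one_apply, Finset.sum_const, nsmul_eq_mul, card_erase_letterInv hr, mul_one]
  exact inv_mul_cancel₀ (two_mul_sub_one_pos hr).ne'

/-- The letter drawn at the last step never acts on the point, so `n + 1` steps produce only `n`
factors `(2r - 1)⁻¹`. -/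
theorem walkOperator_pow_succ_apply (hr : 1 ≤ r) (f : X → ℝ) (n : ℕ) (x : X)
    (a : Fin r × Bool) :
    ((walkOperator r X) ^ (n + 1)) (fun y => f y.1) (x, a) = ((2 * (r : ℝ) - 1)⁻¹) ^ n *
      ∑ L ∈ reducedTails n a, f ((FreeGroup.mk (a :: L))⁻¹ • x) := by
  induction n generalizing x a with
  | zero =>
    rw [zero_add, pow_one, walkOperator_apply]
    simp only [reducedTails, Finset.sum_const, nsmul_eq_mul, card_erase_letterInv hr,
      Finset.sum_singleton, pow_zero, one_mul]
    exact inv_mul_cancel_left₀ (two_mul_sub_one_pos hr).ne' _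
  | succ n ih =>
    rw [pow_succ' (walkOperator r X), Module.End.mul_apply, walkOperator_apply, reducedTails,
      sum_biUnion_image_cons, pow_succ' (_⁻¹ : ℝ), mul_assoc, Finset.mul_sum _ _ (_ ^ n)]
    congr 1
    refine Finset.sum_congr rfl fun b _ => ?_
    rw [ih]
    congr 1
    refine Finset.sum_congr rfl fun L _ => ?_
    rw [smul_smul, ← mul_inv_rev, FreeGroup.mul_mk, List.singleton_append]

theorem sphereAverage_eq_sum_walkOperator (hr : 1 ≤ r) (f : X → ℝ) (n : ℕ) (x : X) :
    sphereAverage (r := r) n f x = (2 * (r : ℝ))⁻¹ *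
      ∑ a : Fin r × Bool, ((walkOperator r X) ^ n) (fun y => f y.1) (x, a) := by
  have hr0 : (0 : ℝ) < r := by exact_mod_cast hr
  cases n with
  | zero =>
    have h0 : freeSphere r 0 = {1} := by
      ext g
      simp [mem_freeSphere, FreeGroup.norm_eq_zero]
    simp only [sphereAverage, h0, pow_zero, Module.End.one_apply]
    simp
    field_simp
  | succ n =>
    have hc := two_mul_sub_one_pos hr
    have key : ∀ u : X → ℝ,
        ∑ a : Fin r × Bool, ((walkOperator r X) ^ (n + 1)) (fun y => u y.1) (x, a) =
        ((2 * (r : ℝ) - 1)⁻¹) ^ n * ∑ g ∈ freeSphere r (n + 1), u (g⁻¹ • x) := by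
      intro u
      rw [sum_freeSphere_succ, Finset.mul_sum]
      exact Finset.sum_congr rfl fun a _ => walkOperator_pow_succ_apply hr u n x a
    have hone : ∀ k, ((walkOperator r X) ^ k) 1 = 1 := by
      intro k
      induction k with
      | zero => rfl
      | succ k ih => rw [pow_succ, Module.End.mul_apply, walkOperator_one hr, ih]
    -- The size of the sphere comes from the same identity with `u = 1`, as `P` fixes constants.
    have hcard : 2 * (r : ℝ) = ((2 * (r : ℝ) - 1)⁻¹) ^ n * (freeSphere r (n + 1)).card := by
      have h := key (fun _ => 1)
      rw [show (fun y : X × (Fin r × Bool) => (1 : ℝ)) = 1 from rfl, hone] at h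
      simp at h
      simpa [mul_comm] using h
    have hp : ((2 * (r : ℝ) - 1)⁻¹) ^ n ≠ 0 := by positivity
    rw [key f, sphereAverage]
    generalize ((2 * (r : ℝ) - 1)⁻¹) ^ n = c at hcard hp ⊢
    rw [hcard]
    rw [mul_inv, mul_mul_mul_comm, inv_mul_cancel₀ hp, one_mul]

/-! ### The invariant measure of the walk -/

variable [MeasurableSpace X]

/-- The product of `μ` with the counting measure on the letters of the free group. -/
noncomputable def letterMeasure (r : ℕ) {X : Type*} [MeasurableSpace X] (μ : Measure X) :
    Measure (X × (Fin r × Bool)) :=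
  ∑ a : Fin r × Bool, μ.map fun x => (x, a)

instance letterMeasure.isFiniteMeasure (μ : Measure X) [IsFiniteMeasure μ] :
    IsFiniteMeasure (letterMeasure r μ) := by
  unfold letterMeasure
  infer_instance

omit [MulAction (FreeGroup (Fin r)) X]

theorem integrable_letterMeasure_iff {μ : Measure X} {φ : X × (Fin r × Bool) → ℝ} :
    Integrable φ (letterMeasure r μ) ↔ ∀ a, Integrable (fun x => φ (x, a)) μ := by
  rw [letterMeasure, integrable_finsetSum_measure]
  simp only [Finset.mem_univ, true_imp_iff]
  exact forall_congr' fun a => (measurableEmbedding_prod_mk_right a).integrable_map_iff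

theorem ae_letterMeasure_iff {μ : Measure X} {p : X × (Fin r × Bool) → Prop} :
    (∀ᵐ y ∂letterMeasure r μ, p y) ↔ ∀ a, ∀ᵐ x ∂μ, p (x, a) := by
  rw [letterMeasure, ae_finsetSum_measure_iff]
  simp only [Finset.mem_univ, true_imp_iff]
  exact forall_congr' fun a => (measurableEmbedding_prod_mk_right a).ae_map_iff

theorem integral_letterMeasure {μ : Measure X} {φ : X × (Fin r × Bool) → ℝ}
    (h : Integrable φ (letterMeasure r μ)) :
    ∫ y, φ y ∂letterMeasure r μ = ∑ a, ∫ x, φ (x, a) ∂μ := by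
  have h' := h
  rw [letterMeasure, integrable_finsetSum_measure] at h'
  rw [letterMeasure, integral_finsetSum_measure h']
  exact Finset.sum_congr rfl fun a _ => (measurableEmbedding_prod_mk_right a).integral_map _

theorem setIntegral_letterMeasure {μ : Measure X} {φ : X × (Fin r × Bool) → ℝ}
    (h : Integrable φ (letterMeasure r μ)) {B : Set X} (hB : MeasurableSet B) :
    ∫ y in Prod.fst ⁻¹' B, φ y ∂letterMeasure r μ = ∑ a, ∫ x in B, φ (x, a) ∂μ := by
  rw [← integral_indicator (measurable_fst hB),
    integral_letterMeasure (h.indicator (measurable_fst hB))]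
  refine Finset.sum_congr rfl fun a _ => ?_
  rw [← integral_indicator hB]
  rfl

variable [MulAction (FreeGroup (Fin r)) X] [MeasurableConstSMul (FreeGroup (Fin r)) X]
  {μ : Measure X} [SMulInvariantMeasure (FreeGroup (Fin r)) X μ]

theorem integrable_walkOperator {φ : X × (Fin r × Bool) → ℝ}
    (h : Integrable φ (letterMeasure r μ)) :
    Integrable (walkOperator r X φ) (letterMeasure r μ) := by
  rw [integrable_letterMeasure_iff] at h ⊢
  intro a
  simp only [walkOperator_apply]
  refine Integrable.const_mul (integrable_finsetSum _ fun b _ => ?_) _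
  exact (measurePreserving_smul _ μ).integrable_comp_of_integrable (h b)

/-- Each letter `b` may follow exactly `2r - 1` letters, all but `b⁻¹`, so summing over the current
letter gives every `b` the same weight; the action preserves `μ` and `B`. -/
theorem setIntegral_walkOperator (hr : 1 ≤ r) {φ : X × (Fin r × Bool) → ℝ}
    (h : Integrable φ (letterMeasure r μ)) {B : Set X} (hB : MeasurableSet B)
    (hinv : ∀ g : FreeGroup (Fin r), (fun x => g • x) ⁻¹' B = B) :
    ∫ y in Prod.fst ⁻¹' B, walkOperator r X φ y ∂letterMeasure r μ =
      ∫ y in Prod.fst ⁻¹' B, φ y ∂letterMeasure r μ := by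
  rw [setIntegral_letterMeasure (integrable_walkOperator h) hB, setIntegral_letterMeasure h hB]
  rw [integrable_letterMeasure_iff] at h
  have hsmul : ∀ (g : FreeGroup (Fin r)) b, ∫ x in B, φ (g • x, b) ∂μ = ∫ x in B, φ (x, b) ∂μ := by
    intro g b
    have := (measurePreserving_smul g μ).setIntegral_preimage_emb
      (measurableEmbedding_const_smul g) (fun x => φ (x, b)) B
    rwa [hinv g] at this
  have hstep : ∀ a, ∫ x in B, walkOperator r X φ (x, a) ∂μ = (2 * (r : ℝ) - 1)⁻¹ *
      (∑ b, ∫ x in B, φ (x, b) ∂μ - ∫ x in B, φ (x, letterInv a) ∂μ) := by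
    intro a
    simp only [walkOperator_apply]
    rw [integral_const_mul, integral_finsetSum]
    · simp only [hsmul]
      rw [Finset.sum_erase_eq_sub (Finset.mem_univ _)]
    · exact fun b _ =>
        ((measurePreserving_smul _ μ).integrable_comp_of_integrable (h b)).integrableOn
  simp only [hstep]
  rw [← Finset.mul_sum, Finset.sum_sub_distrib,
    (letterInv_involutive.bijective).sum_comp fun b => ∫ x in B, φ (x, b) ∂μ]
  have hc := two_mul_sub_one_pos hr
  simp only [Finset.sum_const, Finset.card_univ, Fintype.card_prod, Fintype.card_fin,
    Fintype.card_bool, nsmul_eq_mul]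
  push_cast
  field_simp

theorem isMarkovOperator_walkOperator (hr : 1 ≤ r) :
    IsMarkovOperator (letterMeasure r μ) (walkOperator r X) where
  nonneg φ h := by
    rintro ⟨x, a⟩
    rw [walkOperator_apply]
    exact mul_nonneg (inv_nonneg.2 (two_mul_sub_one_pos hr).le) (Finset.sum_nonneg fun b _ => h _)
  map_one := walkOperator_one hr
  integrable φ h := integrable_walkOperator h
  integral φ h := by
    have := setIntegral_walkOperator hr h (B := Set.univ) MeasurableSet.univ (fun _ => rfl)
    simpa using this

/-! ### Fixed functions of the walk are invariant functions on `X`. -/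

/-- At most two letters are excluded, out of at least four. For rank one, a letter and its inverse
have no common predecessor. -/
theorem exists_letterInv_ne (hr : 2 ≤ r) (a b : Fin r × Bool) :
    ∃ c, a ≠ letterInv c ∧ b ≠ letterInv c := by
  obtain ⟨c, hc⟩ : ∃ c, c ∉ ({letterInv a, letterInv b} : Finset (Fin r × Bool)) := by
    by_contra hcon
    push Not at hcon
    have h1 : (Finset.univ : Finset (Fin r × Bool)).card ≤ 2 :=
      (Finset.card_le_card fun c _ => hcon c).trans Finset.card_le_two
    rw [Finset.card_univ, Fintype.card_prod, Fintype.card_fin, Fintype.card_bool] at h1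
    omega
  simp only [Finset.mem_insert, Finset.mem_singleton, not_or] at hc
  refine ⟨c, ?_, ?_⟩
  · rintro rfl
    exact hc.1 (letterInv_involutive c).symm
  · rintro rfl
    exact hc.2 (letterInv_involutive c).symm

omit [MeasurableSpace X] [MeasurableConstSMul (FreeGroup (Fin r)) X] in
theorem apply_smul_eq_of_letters {Z : Type*} {k : X → Z}
    (h : ∀ (a : Fin r × Bool) x, k ((FreeGroup.mk [a])⁻¹ • x) = k x) (g : FreeGroup (Fin r))
    (x : X) : k (g • x) = k x := by
  have key : ∀ (L : List (Fin r × Bool)) x, k ((FreeGroup.mk L)⁻¹ • x) = k x := by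
    intro L
    induction L with
    | nil => intro x; rw [← FreeGroup.one_eq_mk, inv_one, one_smul]
    | cons a L ih =>
      intro x
      rw [← List.singleton_append, ← FreeGroup.mul_mk, mul_inv_rev, mul_smul, ih, h]
  have := key g⁻¹.toWord x
  rwa [FreeGroup.mk_toWord, inv_inv] at this

theorem aestronglyMeasurable_of_walkOperator_fixed [IsFiniteMeasure μ] (hr : 2 ≤ r)
    {h : X × (Fin r × Bool) → ℝ} (hh : MemLp h 2 (letterMeasure r μ))
    (hfix : walkOperator r X h =ᵐ[letterMeasure r μ] h) :
    AEStronglyMeasurable[(invariantSigma (FreeGroup (Fin r)) X).comap Prod.fst] h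
      (letterMeasure r μ) := by
  have hP := isMarkovOperator_walkOperator (μ := μ) (by omega : 1 ≤ r)
  -- A measurable representative is needed for the set `S` below to be measurable.
  wlog hm : StronglyMeasurable h generalizing h
  · have hae := hh.1.ae_eq_mk
    refine (this (hh.ae_eq hae) ?_ hh.1.stronglyMeasurable_mk).congr hae.symm
    exact ((hP.congr_ae (hh.integrable (by norm_num)) hae).symm.trans hfix).trans hae
  have hm' : ∀ a, Measurable fun x => h (x, a) := fun a =>
    hm.measurable.comp measurable_prodMk_right
  have : Countable (FreeGroup (Fin r)) := FreeGroup.toWord_injective.countable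
  have hloc : ∀ᵐ x ∂μ, ∀ a b : Fin r × Bool, b ≠ letterInv a →
      h ((FreeGroup.mk [a])⁻¹ • x, b) = h (x, a) := by
    rw [ae_all_iff]
    intro a
    have hz := ae_letterMeasure_iff.1 (hP.apply_sq_sub_ae_eq_zero hh hfix) a
    filter_upwards [hz] with x hx b hb
    rw [walkOperator_apply, mul_eq_zero, inv_eq_zero,
      or_iff_right (two_mul_sub_one_pos (by omega)).ne',
      Finset.sum_eq_zero_iff_of_nonneg fun _ _ => sq_nonneg _] at hx
    have := hx b (Finset.mem_erase.2 ⟨hb, Finset.mem_univ _⟩)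
    rwa [sq_eq_zero_iff, sub_eq_zero] at this
  -- Imposing the relations along the whole orbit makes the conull set `S` strictly invariant, as
  -- the exact invariance in `invariantSigma` demands.
  set S : Set X := {x | ∀ (w : FreeGroup (Fin r)) (a b : Fin r × Bool), b ≠ letterInv a →
      h ((FreeGroup.mk [a])⁻¹ • w • x, b) = h (w • x, a)} with hS
  have hSae : ∀ᵐ x ∂μ, x ∈ S := by
    rw [hS]
    simp only [Set.mem_ofPred_eq]
    rw [ae_all_iff]
    exact fun w => (measurePreserving_smul w μ).quasiMeasurePreserving.ae hloc
  have hSm : MeasurableSet S := by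
    have : S = ⋂ (w : FreeGroup (Fin r)) (a : Fin r × Bool) (b : Fin r × Bool)
        (_ : b ≠ letterInv a), {x | h ((FreeGroup.mk [a])⁻¹ • w • x, b) = h (w • x, a)} := by
      ext x
      simp [hS]
    rw [this]
    refine MeasurableSet.iInter fun w => MeasurableSet.iInter fun a => MeasurableSet.iInter
      fun b => MeasurableSet.iInter fun _ => measurableSet_eq_fun ?_ ?_
    · exact (hm' b).comp ((measurable_const_smul _).comp (measurable_const_smul w))
    · exact (hm' a).comp (measurable_const_smul w)
  have hSinv : ∀ (g : FreeGroup (Fin r)) x, x ∈ S → g • x ∈ S := by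
    intro g x hx w a b hb
    have := hx (w * g) a b hb
    rwa [mul_smul] at this
  have hindep : ∀ x ∈ S, ∀ a b, h (x, a) = h (x, b) := by
    intro x hx a b
    obtain ⟨c, hca, hcb⟩ := exists_letterInv_ne hr a b
    -- Both `(x, a)` and `(x, b)` are successors of `(c • x, c)`, so `h` takes its value there at
    -- both.
    have h1 := hx (FreeGroup.mk [c]) c a hca
    have h2 := hx (FreeGroup.mk [c]) c b hcb
    rw [inv_smul_smul] at h1 h2
    rw [h1, h2]
  set o : Fin r × Bool := (⟨0, by omega⟩, true)
  set k : X → ℝ := S.indicator fun x => h (x, o) with hk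
  have hkinv : ∀ (g : FreeGroup (Fin r)) x, k (g • x) = k x := by
    refine apply_smul_eq_of_letters fun a x => ?_
    by_cases hx : x ∈ S
    · have hx' := hSinv (FreeGroup.mk [a])⁻¹ x hx
      rw [hk, Set.indicator_of_mem hx, Set.indicator_of_mem hx']
      -- A letter may follow itself, so `h(a⁻¹x, a) = h(x, a)`; independence of the letter turns
      -- this into invariance under `a`.
      have h1 := hx 1 a a (ne_letterInv_iff.2 fun _ => rfl)
      rw [one_smul] at h1
      rw [hindep _ hx' o a, h1, hindep _ hx a o]
    · have hx' : (FreeGroup.mk [a])⁻¹ • x ∉ S := fun hx' => hx (by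
        have := hSinv (FreeGroup.mk [a]) _ hx'
        rwa [smul_inv_smul] at this)
      rw [hk, Set.indicator_of_notMem hx, Set.indicator_of_notMem hx']
  have hkm : Measurable[invariantSigma (FreeGroup (Fin r)) X] k := by
    intro s hs
    refine measurableSet_invariantSigma.2 ⟨((hm' o).indicator hSm) hs, fun g => ?_⟩
    ext x
    simp only [Set.mem_preimage, hkinv]
  refine ⟨fun y => k y.1, ?_, ?_⟩
  · exact (Measurable.comp hkm (comap_measurable _)).stronglyMeasurable
  · refine ae_letterMeasure_iff.2 fun a => ?_
    filter_upwards [hSae] with x hx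
    show h (x, a) = k x
    rw [hk, Set.indicator_of_mem hx]
    exact hindep x hx a o

/-! ### Descent from `X × letters` to `X`. -/

omit [MeasurableConstSMul (FreeGroup (Fin r)) X]
  [SMulInvariantMeasure (FreeGroup (Fin r)) X μ] in
theorem condExp_letterMeasure_fst [IsFiniteMeasure μ] {f : X → ℝ} (hf : Integrable f μ) :
    (fun y => (μ[f | invariantSigma (FreeGroup (Fin r)) X]) y.1) =ᵐ[letterMeasure r μ]
      (letterMeasure r μ)[fun y => f y.1 |
        (invariantSigma (FreeGroup (Fin r)) X).comap Prod.fst] := by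
  have hle := invariantSigma_le (FreeGroup (Fin r)) X
  have hlift : ∀ {u : X → ℝ}, Integrable u μ →
      Integrable (fun y : X × (Fin r × Bool) => u y.1) (letterMeasure r μ) :=
    fun hu => integrable_letterMeasure_iff.2 fun _ => hu
  refine ae_eq_condExp_of_forall_setIntegral_eq
    ((MeasurableSpace.comap_mono hle).trans measurable_fst.comap_le) (hlift hf)
    (fun _ _ _ => (hlift integrable_condExp).integrableOn) ?_ ?_
  · rintro _ ⟨B, hB, rfl⟩ -
    rw [setIntegral_letterMeasure (hlift integrable_condExp) (hle _ hB),
      setIntegral_letterMeasure (hlift hf) (hle _ hB)]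
    exact Finset.sum_congr rfl fun a _ => setIntegral_condExp hle hf hB
  · exact (Measurable.comp stronglyMeasurable_condExp.measurable
      (comap_measurable _)).stronglyMeasurable.aestronglyMeasurable

theorem tendsto_average_sphereAverage_real [IsFiniteMeasure μ] (hr : 2 ≤ r) {f : X → ℝ}
    (hf : Integrable f μ) :
    ∀ᵐ x ∂μ, Tendsto
      (fun n : ℕ => ((n : ℝ) + 1)⁻¹ * ∑ i ∈ Finset.range (n + 1), sphereAverage (r := r) i f x)
      atTop (𝓝 ((μ[f | invariantSigma (FreeGroup (Fin r)) X]) x)) := by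
  have hr1 : 1 ≤ r := by omega
  have hr0 : (0 : ℝ) < r := by exact_mod_cast hr1
  have hP := isMarkovOperator_walkOperator (μ := μ) hr1
  have hle := invariantSigma_le (FreeGroup (Fin r)) X
  have hfi : Integrable (fun y : X × (Fin r × Bool) => f y.1) (letterMeasure r μ) :=
    integrable_letterMeasure_iff.2 fun _ => hf
  have h1 := hP.tendsto_cesaro ((MeasurableSpace.comap_mono hle).trans measurable_fst.comap_le)
    (by
      rintro _ ⟨B, hB, rfl⟩ g hg
      have hB' := measurableSet_invariantSigma.1 hB
      exact setIntegral_walkOperator hr1 hg hB'.1 hB'.2)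
    (fun h hh hfix => aestronglyMeasurable_of_walkOperator_fixed hr hh hfix) hfi
  have h2 := ae_letterMeasure_iff.1 (h1.and (condExp_letterMeasure_fst hf))
  -- For almost every `x` there is convergence at all of the finitely many `(x, a)`, to a limit free
  -- of `a`; averaging over `a` keeps it.
  filter_upwards [ae_all_iff.2 h2] with x hx
  have h3 : Tendsto (fun n => (2 * (r : ℝ))⁻¹ * ∑ a : Fin r × Bool,
      IsMarkovOperator.cesaro (walkOperator r X) n (fun y => f y.1) (x, a)) atTop
      (𝓝 ((2 * (r : ℝ))⁻¹ * ∑ _a : Fin r × Bool,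
        (μ[f | invariantSigma (FreeGroup (Fin r)) X]) x)) := by
    refine (tendsto_finsetSum _ fun a _ => ?_).const_mul _
    have := (hx a).1
    rwa [← (hx a).2] at this
  have e : (2 * (r : ℝ))⁻¹ * ∑ _a : Fin r × Bool,
      (μ[f | invariantSigma (FreeGroup (Fin r)) X]) x =
      (μ[f | invariantSigma (FreeGroup (Fin r)) X]) x := by
    simp
    field_simp
  rw [e] at h3
  refine h3.congr fun n => ?_
  simp only [IsMarkovOperator.cesaro_apply, sphereAverage_eq_sum_walkOperator hr1]
  rw [← Finset.mul_sum, ← Finset.mul_sum, Finset.sum_comm]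
  exact mul_left_comm _ _ _

end Walk

/-! ### Reduction of scalar values to real and imaginary parts. -/

theorem RCLike.re_sphereAverage {𝕜 X : Type*} [RCLike 𝕜] {r : ℕ}
    [MulAction (FreeGroup (Fin r)) X] (n : ℕ) (f : X → 𝕜) (x : X) :
    RCLike.re (sphereAverage (r := r) n f x) = sphereAverage (r := r) n (fun z => RCLike.re (f z)) x := by
  rw [sphereAverage, sphereAverage, ← RCLike.ofReal_natCast, ← RCLike.ofReal_inv,
    RCLike.re_ofReal_mul, map_sum]

theorem RCLike.im_sphereAverage {𝕜 X : Type*} [RCLike 𝕜] {r : ℕ}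
    [MulAction (FreeGroup (Fin r)) X] (n : ℕ) (f : X → 𝕜) (x : X) :
    RCLike.im (sphereAverage (r := r) n f x) = sphereAverage (r := r) n (fun z => RCLike.im (f z)) x := by
  rw [sphereAverage, sphereAverage, ← RCLike.ofReal_natCast, ← RCLike.ofReal_inv,
    RCLike.im_ofReal_mul, map_sum]

theorem RCLike.tendsto_of_re_im {𝕜 ι : Type*} [RCLike 𝕜] {l : Filter ι} {u : ι → 𝕜} {z : 𝕜}
    (hre : Tendsto (fun i => RCLike.re (u i)) l (𝓝 (RCLike.re z)))
    (him : Tendsto (fun i => RCLike.im (u i)) l (𝓝 (RCLike.im z))) : Tendsto u l (𝓝 z) := by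
  have h := ((RCLike.continuous_ofReal (K := 𝕜)).tendsto _ |>.comp hre).add
    (((RCLike.continuous_ofReal (K := 𝕜)).tendsto _ |>.comp him).mul_const (RCLike.I : 𝕜))
  simpa [Function.comp_def, RCLike.re_add_im] using h

theorem theorem6p4 {𝕜 : Type*} [RCLike 𝕜] (r : ℕ) (hr : 2 ≤ r)
    {X : Type*} [MeasurableSpace X] (μ : Measure X) [IsProbabilityMeasure μ]
    [MulAction (FreeGroup (Fin r)) X] [MeasurableConstSMul (FreeGroup (Fin r)) X]
    [SMulInvariantMeasure (FreeGroup (Fin r)) X μ]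
    (f : X → 𝕜) (hf : MemLLogL f μ) :
    ∀ᵐ x ∂μ, Tendsto
      (fun n : ℕ => ((n : 𝕜) + 1)⁻¹ * ∑ i ∈ Finset.range (n + 1), sphereAverage (r := r) i f x)
      atTop (𝓝 ((μ[f | invariantSigma (FreeGroup (Fin r)) X]) x)) := by
  have hfi := hf.integrable
  have hc : ∀ n : ℕ, ((n : 𝕜) + 1)⁻¹ = ((((n : ℝ) + 1)⁻¹ : ℝ) : 𝕜) := fun n => by push_cast; rfl
  filter_upwards [tendsto_average_sphereAverage_real hr hfi.re,
    tendsto_average_sphereAverage_real hr hfi.im,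
    (RCLike.reCLM (K := 𝕜)).comp_condExp_comm hfi (m := invariantSigma (FreeGroup (Fin r)) X),
    (RCLike.imCLM (K := 𝕜)).comp_condExp_comm hfi (m := invariantSigma (FreeGroup (Fin r)) X)]
    with x h1 h2 h3 h4
  refine RCLike.tendsto_of_re_im ?_ ?_
  · simp only [hc, RCLike.re_ofReal_mul, map_sum, RCLike.re_sphereAverage]
    exact (show RCLike.re _ = _ from h3) ▸ h1
  · simp only [hc, RCLike.im_ofReal_mul, map_sum, RCLike.im_sphereAverage]
    exact (show RCLike.im _ = _ from h4) ▸ h2
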